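/- For an integer $r>1$ let $m_r$ denote the product of all primes $p\le r$. For each real number $k>0$ there exists a constant $c_k>0$, depending only on $k$, such that for each integer $r>1$ the set of positive integers $n$ for which no element of $\{n+1,\ldots,n+r\}$ is coprime to $m_r$ has an asymptotic density, and this density is at most $c_k/r^k$. -/

import Mathlib

open Filter Topology

/-- The set `A` of natural numbers has asymptotic (natural) density `d`: the proportion of
elements of `{1, …, N}` that lie in `A` tends to `d` as `N → ∞`. -/
def HasAsymptoticDensity (A : Set ℕ) (d : ℝ) : Prop :=
  Tendsto (fun N : ℕ => ((A ∩ Set.Icc 1 N).ncard : ℝ) / (N : ℝ)) atTop (𝓝 d)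

/-- The set of positive integers `n` such that no element of `{n + 1, …, n + r}` is coprime to
`m_r = primorial r`, the product of the primes up to `r`. -/
def noCoprimeSet (r : ℕ) : Set ℕ :=
  {n : ℕ | 1 ≤ n ∧ ∀ j ∈ Finset.Icc (n + 1) (n + r), ¬ Nat.Coprime j (primorial r)}

/-! Membership depends only on `n` modulo `primorial r`, so the density exists and is the proportion
of one period. To bound it for large `r`, put L = log r, w ≈ L/4, M = `primorial w`, and keep only
the positions with n + j ≡ 1 mod M. There are at least N = ⌊r/M⌋ ≥ √r of them, and primes up to w
remove none. Primes in (w, z], with z ≈ KL, remove at most half of N, because π(z) ≤ w/4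
(`le_card_survivors`).

For larger primes, the mean of exp(-l·#survivors) over a period is tracked. Undoing the sieve by p
replaces l by l(1 - 2/p), provided l(⌊N/p⌋ + 1) ≤ 1 (`sum_exp_le`). Starting from l = 1 at r, the
primes in (N, r] cost a constant factor c, by a Mertens-type bound; those in (z, N] telescope,
leaving l ≈ cz/N. With N/2 survivors at level z the mean is at most about exp(-cz/2), hence at most
r^(-k) for suitable K. It dominates the proportion of `n` without survivors. -/

/-! ### Periodicity and density. -/

/-- A periodic set of natural numbers has an asymptotic density, equal to the proportion of a
period that it fills. -/
theorem hasAsymptoticDensity_of_periodic {p : ℕ → Prop} [DecidablePred p] {a : ℕ} (ha : 0 < a)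
    (hp : Function.Periodic p a) :
    HasAsymptoticDensity {n | 1 ≤ n ∧ p n} ((Nat.count p a : ℝ) / a) := by
  have hset : ∀ N : ℕ, (({n | 1 ≤ n ∧ p n} ∩ Set.Icc 1 N).ncard) =
      ((Finset.Ico 1 (1 + N)).filter p).card := by
    intro N
    rw [← Set.ncard_coe_finset]
    congr 1
    ext n
    simp only [Set.mem_inter_iff, Set.mem_ofPred_eq, Set.mem_Icc, Finset.coe_filter,
      Finset.mem_Ico]
    constructor
    · rintro ⟨⟨h1, h2⟩, h3, h4⟩
      exact ⟨⟨h1, by omega⟩, h2⟩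
    · rintro ⟨⟨h1, h2⟩, h3⟩
      exact ⟨⟨h1, h3⟩, h1, by omega⟩
  set f : ℕ → ℕ := fun N => ((Finset.Ico 1 (1 + N)).filter p).card with hf
  have hadd : ∀ N, f (N + a) = f N + Nat.count p a := by
    intro N
    have := Nat.filter_Ico_card_eq_of_periodic (1 + N) a p hp
    rw [← this, hf]
    simp only
    rw [← Finset.Ico_union_Ico_eq_Ico (a := 1) (b := 1 + N) (c := 1 + (N + a)) (by omega) (by omega),
      Finset.filter_union, Finset.card_union_of_disjoint, add_assoc]
    exact Finset.disjoint_filter_filter (Finset.Ico_disjoint_Ico_consecutive _ _ _)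
  have hmul : ∀ q s, f (s + a * q) = f s + q * Nat.count p a := by
    intro q s
    induction q with
    | zero => simp
    | succ q ih => rw [mul_add, mul_one, ← add_assoc, hadd, ih]; ring
  have hle : ∀ N, f N ≤ N := by
    intro N
    refine (Finset.card_filter_le _ _).trans ?_
    simp
  have hcount : Nat.count p a ≤ a := Nat.count_le p
  have ha' : (0 : ℝ) < a := by exact_mod_cast ha
  have hbound : ∀ N : ℕ, |(f N : ℝ) - N * ((Nat.count p a : ℝ) / a)| ≤ a := by
    intro N
    have h1 : f N = f (N % a) + (N / a) * Nat.count p a := by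
      conv_lhs => rw [← Nat.mod_add_div N a]
      exact hmul _ _
    have h2 : (N : ℝ) = (N % a : ℕ) + a * (N / a : ℕ) := by
      exact_mod_cast (Nat.mod_add_div N a).symm
    have h3 : (f N : ℝ) - N * ((Nat.count p a : ℝ) / a) =
        f (N % a) - (N % a : ℕ) * ((Nat.count p a : ℝ) / a) := by
      rw [h1, h2]
      push_cast
      field_simp
      ring
    rw [h3]
    have h4 : (f (N % a) : ℝ) ≤ (N % a : ℕ) := by exact_mod_cast hle _
    have h5 : ((N % a : ℕ) : ℝ) ≤ a := by exact_mod_cast (Nat.mod_lt N ha).le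
    have h6 : (Nat.count p a : ℝ) / a ≤ 1 := by
      rw [div_le_one ha']; exact_mod_cast hcount
    have h7 : 0 ≤ (Nat.count p a : ℝ) / a := by positivity
    have h8 : (0 : ℝ) ≤ f (N % a) := by positivity
    have h9 : (0 : ℝ) ≤ (N % a : ℕ) := by positivity
    rw [abs_le]
    constructor <;> nlinarith
  unfold HasAsymptoticDensity
  rw [tendsto_iff_norm_sub_tendsto_zero]
  refine squeeze_zero' (Eventually.of_forall fun _ => norm_nonneg _) ?_
    (tendsto_const_div_atTop_nhds_zero_nat (a : ℝ))
  filter_upwards [eventually_gt_atTop 0] with N hN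
  have hN' : (0 : ℝ) < N := by exact_mod_cast hN
  rw [hset, Real.norm_eq_abs, le_div_iff₀ hN']
  calc _ = |((f N : ℝ) / N - (Nat.count p a : ℝ) / a) * N| := by
        rw [abs_mul, abs_of_pos hN']
    _ = |(f N : ℝ) - N * ((Nat.count p a : ℝ) / a)| := by
        congr 1; field_simp
    _ ≤ a := hbound N

theorem noCoprime_periodic (r : ℕ) : Function.Periodic
    (fun n : ℕ => ∀ j ∈ Finset.Icc (n + 1) (n + r), ¬ Nat.Coprime j (primorial r))
    (primorial r) := by
  have key : ∀ n : ℕ, (∀ j ∈ Finset.Icc (n + 1) (n + r), ¬ Nat.Coprime j (primorial r)) ↔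
      ∀ i ∈ Finset.Icc 1 r, ¬ Nat.Coprime (n + i) (primorial r) := by
    intro n
    simp only [Finset.mem_Icc]
    constructor
    · intro h i hi
      exact h _ (by omega)
    · intro h j hj
      obtain ⟨i, rfl⟩ := Nat.exists_eq_add_of_le (show n ≤ j by omega)
      exact h _ (by omega)
  intro n
  simp only
  rw [key, key]
  simp only [add_right_comm n (primorial r), Nat.coprime_add_self_left]

/-! ### Counting in the progression n + j ≡ 1 mod M. -/

/-- The survivors: indices `j ≤ r` with `n + j ≡ 1` modulo `M` and `n + j` coprime to `a`. -/
def survivors (M r a n : ℕ) : Finset ℕ :=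
  (Finset.Icc 1 r).filter fun j => n + j ≡ 1 [MOD M] ∧ Nat.Coprime (n + j) a

theorem card_le_of_modEq {q r : ℕ} {A : Finset ℕ} (hA : A ⊆ Finset.Icc 1 r)
    (h : ∀ i ∈ A, ∀ j ∈ A, i ≡ j [MOD q]) : A.card ≤ r / q + 1 := by
  rw [← Finset.card_range (r / q + 1)]
  refine Finset.card_le_card_of_injOn (fun j => j / q) ?_ ?_
  · intro j hj
    have := Finset.mem_Icc.1 (hA hj)
    simp only [Finset.coe_range, Set.mem_Iio]
    exact Nat.lt_succ_of_le (Nat.div_le_div_right this.2)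
  · intro i hi j hj hij
    have h1 := h i hi j hj
    simp only at hij
    rw [← Nat.mod_add_div i q, ← Nat.mod_add_div j q, hij, h1]

/-- A residue class modulo `p ∤ M` meets the progression `n + j ≡ 1 [MOD M]` in few points. -/
theorem card_dvd_le {M p r n : ℕ} (h : Nat.Coprime M p)
    {A : Finset ℕ} (hA : A ⊆ Finset.Icc 1 r) (hA1 : ∀ j ∈ A, n + j ≡ 1 [MOD M])
    (hA2 : ∀ j ∈ A, p ∣ n + j) : A.card ≤ r / M / p + 1 := by
  rw [Nat.div_div_eq_div_mul]
  refine card_le_of_modEq hA fun i hi j hj => ?_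
  rw [← Nat.modEq_and_modEq_iff_modEq_mul h]
  constructor
  · exact Nat.ModEq.add_left_cancel' n ((hA1 i hi).trans (hA1 j hj).symm)
  · exact Nat.ModEq.add_left_cancel' n
      ((Nat.modEq_zero_iff_dvd.2 (hA2 i hi)).trans (Nat.modEq_zero_iff_dvd.2 (hA2 j hj)).symm)

theorem le_card_progression {M : ℕ} (hM : 0 < M) (r n : ℕ) :
    r / M ≤ ((Finset.Icc 1 r).filter fun j => n + j ≡ 1 [MOD M]).card := by
  obtain ⟨c, hc1, hcM, hc⟩ : ∃ c, 1 ≤ c ∧ c ≤ M ∧ n + c ≡ 1 [MOD M] := by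
    have hlt := Nat.mod_lt n hM
    rcases Nat.eq_zero_or_pos (n % M) with h0 | h0
    · exact ⟨1, le_rfl, hM, (Nat.modEq_zero_iff_dvd.2 (Nat.dvd_of_mod_eq_zero h0)).add_right 1⟩
    · refine ⟨M + 1 - n % M, by omega, by omega, ?_⟩
      have h1 : n + (M + 1 - n % M) = 1 + M * (n / M + 1) := by
        have := Nat.mod_add_div n M
        rw [mul_add, mul_one]
        omega
      rw [h1]
      exact Nat.add_mul_mod_self_left _ _ _
  conv_lhs => rw [← Finset.card_range (r / M)]
  refine Finset.card_le_card_of_injOn (fun i => i * M + c) ?_ ?_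
  · intro i hi
    simp only [Finset.coe_range, Set.mem_Iio] at hi
    have : (i + 1) * M ≤ r := (Nat.mul_le_mul_right M hi).trans (Nat.div_mul_le_self r M)
    simp only [Finset.coe_filter, Finset.mem_Icc, Set.mem_ofPred_eq]
    refine ⟨⟨by omega, by nlinarith⟩, ?_⟩
    rw [← add_assoc, add_right_comm]
    exact (Nat.add_mul_mod_self_right _ _ _).trans hc
  · intro i _ j _ hij
    simp only [add_left_inj] at hij
    exact Nat.eq_of_mul_eq_mul_right hM hij

/-! ### Exponential moments and sieving by one prime. -/

theorem exp_le_one_add_two_mul {x : ℝ} (h0 : 0 ≤ x) (h1 : x ≤ 1) : Real.exp x ≤ 1 + 2 * x := by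
  have h := Real.abs_exp_sub_one_sub_id_le (x := x) (by rwa [abs_of_nonneg h0])
  have := (abs_le.1 h).2
  nlinarith

theorem sum_range_mul_eq (f : ℕ → ℝ) (a p : ℕ) :
    ∑ n ∈ Finset.range (a * p), f n =
      ∑ n ∈ Finset.range a, ∑ t ∈ Finset.range p, f (n + a * t) := by
  rw [Finset.sum_comm]
  induction p with
  | zero => simp
  | succ p ih =>
    rw [mul_add, mul_one, Finset.sum_range_add, ih, Finset.sum_range_succ]
    simp only [add_comm]

theorem survivors_shift {M r a p n t : ℕ} (hM : M ∣ a) (hp : p.Prime) :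
    survivors M r (a * p) (n + a * t) =
      (survivors M r a n).filter fun j => ¬ p ∣ n + a * t + j := by
  obtain ⟨b, rfl⟩ := hM
  ext j
  have h1 : n + M * b * t + j ≡ 1 [MOD M] ↔ n + j ≡ 1 [MOD M] := by
    rw [add_right_comm, mul_assoc]
    exact (Nat.add_mul_mod_self_left (n + j) M (b * t) : n + j + M * (b * t) ≡ n + j [MOD M]).congr_left
  have h2 : Nat.Coprime (n + M * b * t + j) (M * b) ↔ Nat.Coprime (n + j) (M * b) := by
    rw [add_right_comm, Nat.coprime_add_mul_left_left]
  have h3 : Nat.Coprime (n + M * b * t + j) p ↔ ¬ p ∣ n + M * b * t + j := by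
    rw [Nat.coprime_comm, hp.coprime_iff_not_dvd]
  simp only [survivors, Finset.mem_filter, Nat.coprime_mul_iff_right (m := M * b), h1, h2, h3]
  tauto

/-- Since `a` is invertible modulo `p`, each `j` is removed by at most one lift `t`; count pairs (t,
j) both ways. -/
theorem sum_card_removed_le {a p n : ℕ} (ha : Nat.Coprime a p) (S : Finset ℕ) :
    ∑ t ∈ Finset.range p, (S.filter fun j => p ∣ n + a * t + j).card ≤ S.card := by
  have h := Finset.sum_card_bipartiteAbove_eq_sum_card_bipartiteBelow
    (s := Finset.range p) (t := S) (fun t j => p ∣ n + a * t + j)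
  simp only [Finset.bipartiteAbove, Finset.bipartiteBelow] at h
  rw [h]
  calc _ ≤ ∑ _j ∈ S, 1 := by
        refine Finset.sum_le_sum fun j _ => Finset.card_le_one.2 fun t ht u hu => ?_
        simp only [Finset.mem_filter, Finset.mem_range] at ht hu
        have h1 : n + a * t + j ≡ n + a * u + j [MOD p] :=
          (Nat.modEq_zero_iff_dvd.2 ht.2).trans (Nat.modEq_zero_iff_dvd.2 hu.2).symm
        have h2 : a * t ≡ a * u [MOD p] :=
          Nat.ModEq.add_left_cancel' n (Nat.ModEq.add_right_cancel' j h1)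
        exact (Nat.ModEq.cancel_left_of_coprime ha.symm h2).eq_of_lt_of_lt ht.1 hu.1
    _ = S.card := by simp

/-- The exponential moment of the number of survivors, averaged over `n` modulo `a`. -/
noncomputable def expMoment (M r a : ℕ) (l : ℝ) : ℝ :=
  (∑ n ∈ Finset.range a, Real.exp (-l * (survivors M r a n).card)) / a

/-- The condition `hlp` keeps l·X(t) in [0, 1], where e^x ≤ 1 + 2x, so only the mean of X(t)
matters, and it is at most |S|/p. Then 1 + y ≤ e^y restores an exponential. -/
theorem sum_exp_le {M r a p n : ℕ} {l : ℝ} (hM : M ∣ a) (hp : p.Prime) (ha : Nat.Coprime a p)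
    (hl : 0 ≤ l) (hlp : l * (r / M / p + 1 : ℕ) ≤ 1) :
    ∑ t ∈ Finset.range p, Real.exp (-l * (survivors M r (a * p) (n + a * t)).card) ≤
      p * Real.exp (-(l * (1 - 2 / p)) * (survivors M r a n).card) := by
  set S := survivors M r a n with hS
  have hp0 : (0 : ℝ) < p := by exact_mod_cast hp.pos
  have hMp : Nat.Coprime M p := ha.coprime_dvd_left hM
  let X : ℕ → ℕ := fun t => (S.filter fun j => p ∣ n + a * t + j).card
  have hX : ∀ t, X t ≤ r / M / p + 1 := by
    intro t
    refine card_dvd_le (n := n + a * t) hMp ?_ ?_ ?_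
    · exact (Finset.filter_subset _ _).trans (Finset.filter_subset _ _)
    · intro j hj
      have hj' := (Finset.mem_filter.1 (Finset.mem_filter.1 hj).1).2.1
      obtain ⟨b, rfl⟩ := hM
      rw [add_right_comm, mul_assoc]
      exact (Nat.add_mul_mod_self_left _ _ _).trans hj'
    · intro j hj
      exact (Finset.mem_filter.1 hj).2
  have hcard : ∀ t, ((survivors M r (a * p) (n + a * t)).card : ℝ) = S.card - X t := by
    intro t
    rw [survivors_shift hM hp, eq_sub_iff_add_eq, ← hS]
    have := Finset.card_filter_add_card_filter_not (s := S) (fun j => p ∣ n + a * t + j)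
    rw [add_comm] at this
    exact_mod_cast this
  have hsum : (∑ t ∈ Finset.range p, (X t : ℝ)) ≤ S.card := by
    exact_mod_cast sum_card_removed_le (n := n) ha S
  calc _ = ∑ t ∈ Finset.range p, Real.exp (-l * S.card) * Real.exp (l * X t) := by
        refine Finset.sum_congr rfl fun t _ => ?_
        rw [hcard, ← Real.exp_add]
        congr 1; ring
    _ ≤ ∑ t ∈ Finset.range p, Real.exp (-l * S.card) * (1 + 2 * (l * X t)) := by
        refine Finset.sum_le_sum fun t _ => ?_
        refine mul_le_mul_of_nonneg_left (exp_le_one_add_two_mul (by positivity) ?_)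
          (Real.exp_pos _).le
        refine (mul_le_mul_of_nonneg_left ?_ hl).trans hlp
        exact_mod_cast hX t
    _ = Real.exp (-l * S.card) * (p + 2 * l * ∑ t ∈ Finset.range p, (X t : ℝ)) := by
        rw [← Finset.mul_sum, Finset.sum_add_distrib, Finset.mul_sum]
        simp [mul_assoc]
    _ ≤ Real.exp (-l * S.card) * (p + 2 * l * S.card) := by
        gcongr
    _ = p * (Real.exp (-l * S.card) * (2 * l * S.card / p + 1)) := by
        field_simp; ring
    _ ≤ p * (Real.exp (-l * S.card) * Real.exp (2 * l * S.card / p)) := by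
        gcongr; exact Real.add_one_le_exp _
    _ = _ := by
        rw [← Real.exp_add]
        congr 2; field_simp; ring

theorem expMoment_mul_le {M r a p : ℕ} {l : ℝ} (hM : M ∣ a) (hp : p.Prime)
    (ha : Nat.Coprime a p) (hl : 0 ≤ l) (hlp : l * (r / M / p + 1 : ℕ) ≤ 1) :
    expMoment M r (a * p) l ≤ expMoment M r a (l * (1 - 2 / p)) := by
  have hp0 : (0 : ℝ) < p := by exact_mod_cast hp.pos
  unfold expMoment
  rw [sum_range_mul_eq, Nat.cast_mul, mul_comm (a : ℝ), ← div_div]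
  refine div_le_div_of_nonneg_right ?_ (Nat.cast_nonneg a)
  rw [div_le_iff₀ hp0, mul_comm (∑ n ∈ _, _), Finset.mul_sum]
  exact Finset.sum_le_sum fun n _ => sum_exp_le hM hp ha hl hlp

theorem expMoment_anti {M r a : ℕ} {l l' : ℝ} (h : l ≤ l') :
    expMoment M r a l' ≤ expMoment M r a l := by
  unfold expMoment
  gcongr

theorem expMoment_le {M r a : ℕ} {l s : ℝ} (ha : 0 < a) (hl : 0 ≤ l)
    (h : ∀ n, s ≤ (survivors M r a n).card) : expMoment M r a l ≤ Real.exp (-l * s) := by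
  have ha' : (0 : ℝ) < a := by exact_mod_cast ha
  unfold expMoment
  rw [div_le_iff₀ ha', mul_comm]
  calc _ ≤ ∑ n ∈ Finset.range a, Real.exp (-l * s) := by
        refine Finset.sum_le_sum fun n _ => Real.exp_le_exp.2 ?_
        rw [neg_mul, neg_mul]
        exact neg_le_neg (mul_le_mul_of_nonneg_left (h n) hl)
    _ = _ := by simp

/-! ### Sieving by ranges of primes. -/

theorem primorial_succ_of_prime {m : ℕ} (h : (m + 1).Prime) :
    primorial (m + 1) = primorial m * (m + 1) := by
  rw [primorial, primorial, Finset.range_add_one, Finset.filter_insert, if_pos h,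
    Finset.prod_insert (by simp), mul_comm]

theorem primorial_succ_of_not_prime {m : ℕ} (h : ¬ (m + 1).Prime) :
    primorial (m + 1) = primorial m := by
  rw [primorial, primorial, Finset.range_add_one, Finset.filter_insert, if_neg h]

theorem coprime_primorial_succ {m : ℕ} (h : (m + 1).Prime) :
    Nat.Coprime (primorial m) (m + 1) := by
  rw [Nat.coprime_comm, h.coprime_iff_not_dvd, h.dvd_primorial_iff]
  omega

/-- Sieving by one more integer `m + 1` in the range `w ≤ m`. -/
theorem expMoment_primorial_succ_le {w r m : ℕ} {l l' : ℝ} (hw : w ≤ m) (hl : 0 ≤ l)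
    (hlp : l * (r / primorial w / (m + 1) + 1 : ℕ) ≤ 1) (hll : l' ≤ l)
    (hlp' : (m + 1).Prime → l' ≤ l * (1 - 2 / (m + 1 : ℕ))) :
    expMoment (primorial w) r (primorial (m + 1)) l ≤
      expMoment (primorial w) r (primorial m) l' := by
  by_cases h : (m + 1).Prime
  · rw [primorial_succ_of_prime h]
    exact (expMoment_mul_le (primorial_dvd_primorial hw) h (coprime_primorial_succ h) hl hlp).trans
      (expMoment_anti (hlp' h))
  · rw [primorial_succ_of_not_prime h]
    exact expMoment_anti hll

/-- Sieving by the primes in `(r / primorial w, m]`. -/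
theorem expMoment_le_of_large {w r m : ℕ} (hw : w ≤ r / primorial w) (h2 : 2 ≤ r / primorial w)
    (hm : r / primorial w ≤ m) :
    ∀ l : ℝ, 0 ≤ l → l ≤ 1 →
    expMoment (primorial w) r (primorial m) l ≤
      expMoment (primorial w) r (primorial (r / primorial w))
        (l * ∏ p ∈ (Finset.Ioc (r / primorial w) m).filter Nat.Prime, (1 - 2 / (p : ℝ))) := by
  induction m, hm using Nat.le_induction with
  | base => intro l _ _; simp
  | succ m hm ih =>
    intro l hl hl1
    -- Beyond N the quotient vanishes, so the condition on `l` is just l ≤ 1.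
    have hdiv : r / primorial w / (m + 1) = 0 := Nat.div_eq_of_lt (by omega)
    have hm1 : (2 : ℝ) / (m + 1 : ℕ) ≤ 1 := by
      rw [div_le_one (by positivity)]
      exact_mod_cast (by omega : 2 ≤ m + 1)
    rw [← Finset.insert_Ioc_right_eq_Ioc_add_one (by omega), Finset.filter_insert]
    split_ifs with h
    · rw [Finset.prod_insert (by simp), ← mul_assoc]
      have h3 : l * (1 - 2 / (m + 1 : ℕ)) ≤ l := by
        have : 0 ≤ (2 : ℝ) / (m + 1 : ℕ) := by positivity
        nlinarith
      refine le_trans ?_ (ih _ (mul_nonneg hl (by linarith)) (h3.trans hl1))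
      exact expMoment_primorial_succ_le (hw.trans hm) hl (by simpa [hdiv]) h3 fun _ => le_rfl
    · refine le_trans ?_ (ih l hl hl1)
      exact expMoment_primorial_succ_le (hw.trans hm) hl (by simpa [hdiv]) le_rfl
        fun h' => absurd h' h

/-- Sieving by the primes in `(z, m]`, for `m ≤ r / primorial w`. -/
theorem expMoment_le_of_small {w z r m : ℕ} {c : ℝ} (hc : 0 ≤ c) (hc1 : c ≤ 1 / 2) (hz : w ≤ z)
    (hz2 : 2 ≤ z) (hm : z ≤ m) (hmN : m ≤ r / primorial w) :
    expMoment (primorial w) r (primorial m)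
        (c * (2 * ((m + 1) / 2) - 1 : ℕ) / (r / primorial w : ℕ)) ≤
      expMoment (primorial w) r (primorial z)
        (c * (2 * ((z + 1) / 2) - 1 : ℕ) / (r / primorial w : ℕ)) := by
  -- The weight `2 * ((m + 1) / 2) - 1` is the largest odd integer up to `m`. At an odd prime p it
  -- drops from p to p - 2 on passing to p - 1, which is exactly the factor 1 - 2/p.
  induction m, hm using Nat.le_induction with
  | base => exact le_rfl
  | succ m hm ih =>
    refine le_trans ?_ (ih (by omega))
    set N := r / primorial w with hN
    have hN0 : (0 : ℝ) < N := by exact_mod_cast (by omega : 0 < N)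
    have hm0 : (0 : ℝ) < (m + 1 : ℕ) := by positivity
    refine expMoment_primorial_succ_le (hz.trans hm) (by positivity) ?_ ?_ ?_
    · rw [← hN]
      have h1 : ((2 * ((m + 1 + 1) / 2) - 1 : ℕ) : ℝ) ≤ (m + 1 : ℕ) := by
        exact_mod_cast (by omega)
      have h2 : ((N / (m + 1) + 1 : ℕ) : ℝ) ≤ 2 * (N / (m + 1 : ℕ)) := by
        have h3 : ((N / (m + 1) : ℕ) : ℝ) ≤ N / (m + 1 : ℕ) := Nat.cast_div_le
        have h4 : (1 : ℝ) ≤ N / (m + 1 : ℕ) := by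
          rw [one_le_div hm0]; exact_mod_cast hmN
        push_cast at *
        linarith
      calc _ ≤ c * (m + 1 : ℕ) / N * (2 * (N / (m + 1 : ℕ))) := by gcongr
        _ = 2 * c := by field_simp
        _ ≤ 1 := by linarith
    · gcongr
      omega
    · intro hp
      have hodd : Odd (m + 1) := hp.odd_of_ne_two (by omega)
      obtain ⟨i, hi⟩ := hodd
      have hi1 : 1 ≤ i := by omega
      have hm' : m = 2 * i := by omega
      have e1 : 2 * ((m + 1) / 2) - 1 = 2 * i - 1 := by omega
      have e2 : 2 * ((m + 1 + 1) / 2) - 1 = 2 * i + 1 := by omega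
      rw [e1, e2, hi, Nat.cast_sub (by omega)]
      push_cast
      have : (0 : ℝ) < 2 * i + 1 := by positivity
      apply le_of_eq
      field_simp
      ring

/-! ### A Mertens-type bound from the factorial. -/

/-- Only the first term of Legendre's formula is kept. -/
theorem prod_pow_div_dvd_factorial (N r : ℕ) :
    ∏ p ∈ (Finset.Ioc N r).filter Nat.Prime, p ^ (r / p) ∣ r.factorial := by
  refine Finset.prod_dvd_of_isRelPrime ?_ ?_
  · intro p hp q hq hpq
    have hp' := (Finset.mem_filter.1 hp).2
    have hq' := (Finset.mem_filter.1 hq).2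
    exact Nat.coprime_iff_isRelPrime.1 (Nat.Coprime.pow _ _ ((Nat.coprime_primes hp' hq').2 hpq))
  · intro p hp
    obtain ⟨hp1, hp2⟩ := Finset.mem_filter.1 hp
    have hle := (Finset.mem_Ioc.1 hp1).2
    rw [hp2.pow_dvd_factorial_iff (Nat.lt_succ_self _)]
    have hlog : 1 ≤ Nat.log p r := Nat.log_pos hp2.one_lt hle
    have := Finset.single_le_sum (f := fun i => r / p ^ i) (s := Finset.Ico 1 (Nat.log p r + 1))
      (fun _ _ => Nat.zero_le _) (Finset.mem_Ico.2 ⟨le_rfl, by omega⟩)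
    simpa using this

theorem sum_log_mul_div_le (N r : ℕ) :
    ∑ p ∈ (Finset.Ioc N r).filter Nat.Prime, Real.log p * (r / p : ℕ) ≤ r * Real.log r := by
  have h1 : (((∏ p ∈ (Finset.Ioc N r).filter Nat.Prime, p ^ (r / p)) : ℕ) : ℝ) ≤ (r : ℝ) ^ r := by
    exact_mod_cast (Nat.le_of_dvd (Nat.factorial_pos r) (prod_pow_div_dvd_factorial N r)).trans
      (Nat.factorial_le_pow r)
  have hpos : ∀ p ∈ (Finset.Ioc N r).filter Nat.Prime, ((p : ℝ) ^ (r / p)) ≠ 0 := fun p hp =>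
    pow_ne_zero _ (by exact_mod_cast (Finset.mem_filter.1 hp).2.ne_zero)
  rw [Nat.cast_prod] at h1
  simp only [Nat.cast_pow] at h1
  have h2 := Real.log_le_log (Finset.prod_pos fun p hp =>
    lt_of_le_of_ne (by positivity) (hpos p hp).symm) h1
  rw [Real.log_prod hpos, Real.log_pow] at h2
  simpa only [Real.log_pow, mul_comm (Real.log _) (Nat.cast (_ / _))] using h2

theorem sum_log_le (N r : ℕ) :
    ∑ p ∈ (Finset.Ioc N r).filter Nat.Prime, Real.log p ≤ Real.log 4 * r := by
  refine le_trans ?_ (Chebyshev.theta_le_log4_mul_x (Nat.cast_nonneg r))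
  rw [Chebyshev.theta, Nat.floor_natCast]
  refine Finset.sum_le_sum_of_subset_of_nonneg ?_ fun p _ _ => Real.log_natCast_nonneg p
  exact Finset.filter_subset_filter _ (Finset.Ioc_subset_Ioc_left (Nat.zero_le N))

/-- A bound of Mertens type for the sum of the reciprocals of the primes in `(N, r]`. -/
theorem sum_inv_prime_le {N r : ℕ} (hN : 2 ≤ N) (hr : 0 < r) :
    ∑ p ∈ (Finset.Ioc N r).filter Nat.Prime, (1 / p : ℝ) ≤
      (Real.log r + Real.log 4) / Real.log N := by
  have hr' : (0 : ℝ) < r := by exact_mod_cast hr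
  have hlogN : 0 < Real.log N := Real.log_pos (by exact_mod_cast hN)
  rw [le_div_iff₀ hlogN]
  refine le_of_mul_le_mul_left ?_ hr'
  calc _ = ∑ p ∈ (Finset.Ioc N r).filter Nat.Prime, Real.log N * (r / p : ℝ) := by
        rw [Finset.sum_mul, Finset.mul_sum]
        exact Finset.sum_congr rfl fun p _ => by ring
    _ ≤ ∑ p ∈ (Finset.Ioc N r).filter Nat.Prime,
          (Real.log p * (r / p : ℕ) + Real.log p) := by
        refine Finset.sum_le_sum fun p hp => ?_
        have hp1 := Finset.mem_Ioc.1 (Finset.mem_filter.1 hp).1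
        have h1 : Real.log N ≤ Real.log p :=
          Real.log_le_log (by exact_mod_cast (by omega : 0 < N)) (by exact_mod_cast hp1.1.le)
        have h2 : (r : ℝ) / p ≤ (r / p : ℕ) + 1 := by
          rw [← Nat.floor_div_eq_div (K := ℝ)]
          exact (Nat.lt_floor_add_one _).le
        calc _ ≤ Real.log p * ((r / p : ℕ) + 1) := by gcongr
          _ = _ := by ring
    _ ≤ r * Real.log r + Real.log 4 * r := by
        rw [Finset.sum_add_distrib]
        exact add_le_add (sum_log_mul_div_le N r) (sum_log_le N r)
    _ = _ := by ring

theorem one_sub_ge_exp {x : ℝ} (h0 : 0 ≤ x) (h1 : x ≤ 1 / 2) : Real.exp (-2 * x) ≤ 1 - x := by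
  have h := Real.exp_bound_div_one_sub_of_interval h0 (by linarith)
  have h2 : 1 + x ≤ Real.exp x := by linarith [Real.add_one_le_exp x]
  have h3 : Real.exp (-2 * x) = 1 / (Real.exp x * Real.exp x) := by
    rw [one_div, ← Real.exp_add, ← Real.exp_neg]; congr 1; ring
  rw [h3, div_le_iff₀ (by positivity)]
  have h4 : (1 + x) * (1 + x) ≤ Real.exp x * Real.exp x := by gcongr
  have h5 : 1 ≤ (1 - x) * ((1 + x) * (1 + x)) := by
    nlinarith [mul_nonneg h0 (by nlinarith : 0 ≤ 1 - x - x ^ 2)]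
  nlinarith

theorem prod_one_sub_two_div_ge {N r : ℕ} {C : ℝ} (hN : 3 ≤ N)
    (hC : ∑ p ∈ (Finset.Ioc N r).filter Nat.Prime, (1 / p : ℝ) ≤ C) :
    Real.exp (-4 * C) ≤ ∏ p ∈ (Finset.Ioc N r).filter Nat.Prime, (1 - 2 / (p : ℝ)) := by
  calc _ ≤ Real.exp (∑ p ∈ (Finset.Ioc N r).filter Nat.Prime, -2 * (2 / p : ℝ)) := by
        rw [← Finset.mul_sum, Real.exp_le_exp]
        have : ∑ p ∈ (Finset.Ioc N r).filter Nat.Prime, (2 / p : ℝ) =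
            2 * ∑ p ∈ (Finset.Ioc N r).filter Nat.Prime, (1 / p : ℝ) := by
          rw [Finset.mul_sum]
          exact Finset.sum_congr rfl fun p _ => by ring
        rw [this]
        linarith
    _ ≤ _ := by
        rw [Real.exp_sum]
        refine Finset.prod_le_prod (fun _ _ => (Real.exp_pos _).le) fun p hp => ?_
        have hp1 := Finset.mem_Ioc.1 (Finset.mem_filter.1 hp).1
        have hp4 : (4 : ℝ) ≤ p := by exact_mod_cast (by omega : 4 ≤ p)
        refine one_sub_ge_exp (by positivity) ?_
        rw [div_le_iff₀ (by linarith)]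
        linarith

/-! ### The initial sieve and the combined bound. -/

/-- Few elements of the progression are removed by the primes in `(w, z]`. -/
theorem le_card_survivors {w z r : ℕ} (hw : 0 < w) (hπ : 4 * Nat.primeCounting z ≤ w)
    (hz : 4 * z ≤ r / primorial w) (n : ℕ) :
    ((r / primorial w : ℕ) : ℝ) / 2 ≤ (survivors (primorial w) r (primorial z) n).card := by
  classical
  set N := r / primorial w with hN
  set P := (Finset.Icc 1 r).filter fun j => n + j ≡ 1 [MOD primorial w] with hP
  set Q := (Finset.Ioc w z).filter Nat.Prime with hQ
  have hsub : P ⊆ survivors (primorial w) r (primorial z) n ∪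
      Q.biUnion fun p => P.filter fun j => p ∣ n + j := by
    intro j hj
    obtain ⟨hj1, hj2⟩ := Finset.mem_filter.1 hj
    by_cases hc : Nat.Coprime (n + j) (primorial z)
    · exact Finset.mem_union_left _ (Finset.mem_filter.2 ⟨hj1, hj2, hc⟩)
    · obtain ⟨p, hp, hpn, hpz⟩ := Nat.Prime.not_coprime_iff_dvd.1 hc
      refine Finset.mem_union_right _ (Finset.mem_biUnion.2 ⟨p, ?_, Finset.mem_filter.2 ⟨hj, hpn⟩⟩)
      refine Finset.mem_filter.2 ⟨Finset.mem_Ioc.2 ⟨?_, hp.dvd_primorial_iff.1 hpz⟩, hp⟩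
      -- A prime p ≤ w divides `primorial w`, so n + j ≡ 1 mod p.
      by_contra hle
      have h1 : n + j ≡ 1 [MOD p] := hj2.of_dvd (hp.dvd_primorial_iff.2 (by omega))
      have h2 : 0 ≡ 1 [MOD p] := (Nat.modEq_zero_iff_dvd.2 hpn).symm.trans h1
      exact hp.one_lt.ne' ((Nat.modEq_zero_iff_dvd.1 h2.symm).antisymm (one_dvd p) |> fun h => by
        simpa using h)
  have hcardQ : Q.card ≤ Nat.primeCounting z := by
    rw [← Nat.primesLE_card_eq_primeCounting, Nat.primesLE_eq_filter_Ioc_zero]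
    exact Finset.card_le_card
      (Finset.filter_subset_filter _ (Finset.Ioc_subset_Ioc_left (Nat.zero_le w)))
  have hcardQ' : Q.card ≤ z := by
    refine (Finset.card_filter_le _ _).trans ?_
    simp
  have hrem : (Q.biUnion fun p => P.filter fun j => p ∣ n + j).card ≤ Q.card * (N / w + 1) := by
    refine Finset.card_biUnion_le_card_mul _ _ _ fun p hp => ?_
    obtain ⟨hp1, hp2⟩ := Finset.mem_filter.1 hp
    have hwp := (Finset.mem_Ioc.1 hp1).1
    have hcop : Nat.Coprime (primorial w) p := by
      rw [Nat.coprime_comm, hp2.coprime_iff_not_dvd, hp2.dvd_primorial_iff]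
      omega
    refine (card_dvd_le (n := n) hcop ((Finset.filter_subset _ _).trans (Finset.filter_subset _ _))
      (fun j hj => (Finset.mem_filter.1 (Finset.mem_filter.1 hj).1).2)
      fun j hj => (Finset.mem_filter.1 hj).2).trans ?_
    rw [← hN]
    exact Nat.add_le_add_right (Nat.div_le_div_left hwp.le hw) 1
  have h1 : N ≤ (survivors (primorial w) r (primorial z) n).card + Q.card * (N / w + 1) :=
    (le_card_progression (primorial_pos w) r n).trans <| (Finset.card_le_card hsub).trans <|
      (Finset.card_union_le _ _).trans (Nat.add_le_add_left hrem _)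
  have h2 : 4 * (Q.card * (N / w)) ≤ N := by
    calc _ ≤ (4 * Nat.primeCounting z) * (N / w) := by
          rw [← mul_assoc]; gcongr
      _ ≤ w * (N / w) := by gcongr
      _ ≤ N := Nat.mul_div_le N w
  -- The removed part is |Q|·⌊N/w⌋ + |Q|, and each term is at most N/4.
  have h3 : N ≤ 2 * (survivors (primorial w) r (primorial z) n).card := by
    rw [mul_add, mul_one] at h1
    omega
  rw [div_le_iff₀ two_pos, mul_comm]
  exact_mod_cast h3

theorem expMoment_final_le {w z r : ℕ} {c : ℝ} (hw : 0 < w) (hwz : w ≤ z) (hz2 : 2 ≤ z)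
    (hπ : 4 * Nat.primeCounting z ≤ w) (hz : 4 * z ≤ r / primorial w) (hc : 0 ≤ c)
    (hc1 : c ≤ 1 / 2)
    (hc2 : c ≤ ∏ p ∈ (Finset.Ioc (r / primorial w) r).filter Nat.Prime, (1 - 2 / (p : ℝ))) :
    expMoment (primorial w) r (primorial r) 1 ≤ Real.exp (-(c * (z - 1) / 2)) := by
  set N := r / primorial w with hN
  have hNr : N ≤ r := Nat.div_le_self _ _
  have hN0 : (0 : ℝ) < N := by exact_mod_cast (by omega : 0 < N)
  have ho : ((2 * ((N + 1) / 2) - 1 : ℕ) : ℝ) ≤ N := by exact_mod_cast (by omega)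
  have ho' : (z : ℝ) - 1 ≤ ((2 * ((z + 1) / 2) - 1 : ℕ) : ℝ) := by
    rw [sub_le_iff_le_add]; exact_mod_cast (by omega)
  calc _ ≤ expMoment (primorial w) r (primorial N)
        (1 * ∏ p ∈ (Finset.Ioc N r).filter Nat.Prime, (1 - 2 / (p : ℝ))) :=
        expMoment_le_of_large (by omega) (by omega) hNr 1 zero_le_one le_rfl
    _ ≤ expMoment (primorial w) r (primorial N) (c * (2 * ((N + 1) / 2) - 1 : ℕ) / N) := by
        refine expMoment_anti ?_
        rw [one_mul, div_le_iff₀ hN0]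
        exact mul_le_mul hc2 ho (Nat.cast_nonneg _) (hc.trans hc2)
    _ ≤ expMoment (primorial w) r (primorial z) (c * (2 * ((z + 1) / 2) - 1 : ℕ) / N) :=
        expMoment_le_of_small hc hc1 hwz hz2 (by omega) le_rfl
    _ ≤ Real.exp (-(c * (2 * ((z + 1) / 2) - 1 : ℕ) / N) * (N / 2)) :=
        expMoment_le (primorial_pos z) (by positivity) (le_card_survivors hw hπ hz)
    _ ≤ _ := by
        rw [Real.exp_le_exp]
        have : -(c * (2 * ((z + 1) / 2) - 1 : ℕ) / N) * ((N : ℝ) / 2) =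
            -(c * (2 * ((z + 1) / 2) - 1 : ℕ) / 2) := by field_simp
        rw [this]
        gcongr

/-- The indicator of having no survivors is at most exp(-#survivors). -/
theorem count_div_le_expMoment (M r : ℕ) (p : ℕ → Prop) [DecidablePred p]
    (hp : ∀ n, p n → ∀ j ∈ Finset.Icc (n + 1) (n + r), ¬ Nat.Coprime j (primorial r)) :
    (Nat.count p (primorial r) : ℝ) / (primorial r : ℕ) ≤ expMoment M r (primorial r) 1 := by
  unfold expMoment
  gcongr
  rw [Nat.count_eq_card_filter_range, Finset.card_filter, Nat.cast_sum]
  refine Finset.sum_le_sum fun n _ => ?_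
  split_ifs with h
  · have : survivors M r (primorial r) n = ∅ := by
      refine Finset.eq_empty_of_forall_notMem fun j hj => ?_
      obtain ⟨hj1, _, hj3⟩ := Finset.mem_filter.1 hj
      rw [Finset.mem_Icc] at hj1
      exact hp n h (n + j) (Finset.mem_Icc.2 (by omega)) hj3
    simp [this]
  · simpa using (Real.exp_pos _).le

/-! ### Choice of parameters. -/

theorem eventually_primeCounting_le_mul {δ : ℝ} (hδ : 0 < δ) :
    ∀ᶠ n : ℕ in atTop, (Nat.primeCounting n : ℝ) ≤ δ * n := by
  have h1 := tendsto_natCast_atTop_atTop (R := ℝ) |>.eventually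
    (Chebyshev.eventually_primeCounting_le one_pos)
  have h2 := (Real.tendsto_log_atTop.comp (tendsto_natCast_atTop_atTop (R := ℝ))).eventually
    (eventually_ge_atTop ((Real.log 4 + 1) / δ + 1))
  filter_upwards [h1, h2] with n hn hlog
  have h4 : 0 ≤ Real.log 4 := Real.log_nonneg (by norm_num)
  have h5 : 0 ≤ (Real.log 4 + 1) / δ := by positivity
  simp only [Function.comp] at hlog
  rw [Nat.floor_natCast] at hn
  refine hn.trans ?_
  rw [div_le_iff₀ (by linarith)]
  have h6 : Real.log 4 + 1 ≤ δ * Real.log n := by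
    have : (Real.log 4 + 1) / δ ≤ Real.log n := by linarith
    rw [div_le_iff₀ hδ] at this
    linarith
  nlinarith [mul_le_mul_of_nonneg_right h6 (Nat.cast_nonneg (α := ℝ) n)]

/-- Here `primorial w` ≤ 4^w ≤ r^0.35, so the quotient is at least r^0.65 - 1. -/
theorem exp_half_le_div_primorial {r w : ℕ} (hr : 0 < r) (hL : 20 ≤ Real.log r)
    (hw : (w : ℝ) ≤ Real.log r / 4) : Real.exp (Real.log r / 2) ≤ (r / primorial w : ℕ) := by
  set L := Real.log r with hLdef
  have hr' : (0 : ℝ) < r := by exact_mod_cast hr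
  have hrL : (r : ℝ) = Real.exp L := (Real.exp_log hr').symm
  have hM0 : (0 : ℝ) < primorial w := by exact_mod_cast primorial_pos w
  have h1 : (primorial w : ℝ) ≤ Real.exp (Real.log 4 * w) := by
    rw [Real.exp_mul, Real.exp_log (by norm_num), Real.rpow_natCast]
    exact_mod_cast primorial_le_four_pow w
  have hlog4 : Real.log 4 ≤ 1.4 := by
    rw [show (4 : ℝ) = 2 ^ 2 by norm_num, Real.log_pow]
    have := Real.log_two_lt_d9
    push_cast
    linarith
  have h2 : (primorial w : ℝ) ≤ Real.exp (0.35 * L) := by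
    refine h1.trans (Real.exp_le_exp.2 ?_)
    have : (0 : ℝ) ≤ w := Nat.cast_nonneg w
    nlinarith
  have h3 : Real.exp (0.65 * L) ≤ (r : ℝ) / primorial w := by
    rw [le_div_iff₀ hM0, hrL]
    calc _ ≤ Real.exp (0.65 * L) * Real.exp (0.35 * L) := by gcongr
      _ = _ := by rw [← Real.exp_add]; congr 1; ring
  have h4 : (r : ℝ) / primorial w ≤ (r / primorial w : ℕ) + 1 := by
    rw [← Nat.floor_div_eq_div (K := ℝ)]
    exact (Nat.lt_floor_add_one _).le
  have h5 : Real.exp (0.65 * L) = Real.exp (L / 2) * Real.exp (0.15 * L) := by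
    rw [← Real.exp_add]; congr 1; ring
  have h6 : 2 ≤ Real.exp (0.15 * L) := by linarith [Real.add_one_le_exp (0.15 * L)]
  have h7 : 1 ≤ Real.exp (L / 2) := Real.one_le_exp (by linarith)
  nlinarith

theorem expMoment_le_rpow {k : ℝ} (hk : 0 < k) :
    ∃ r₀ : ℕ, ∀ r : ℕ, r₀ ≤ r →
      ∃ M, expMoment M r (primorial r) 1 ≤ 1 / (r : ℝ) ^ k := by
  -- The reciprocals of the primes in (N, r] sum to at most 4, so the product of 1 - 2/p is at least
  -- exp(-4·4). `K` is chosen so that cK ≥ 2k.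
  set c := Real.exp (-16) with hc
  have hc0 : 0 < c := Real.exp_pos _
  have hc1 : c ≤ 1 / 2 := by
    rw [hc, Real.exp_neg, ← one_div]
    exact one_div_le_one_div_of_le two_pos (by linarith [Real.add_one_le_exp 16])
  set K := 2 * k / c + 1 with hK
  have hK1 : 1 ≤ K := by
    have : 0 ≤ 2 * k / c := by positivity
    linarith
  obtain ⟨Z, hZ⟩ := eventually_atTop.1
    (eventually_primeCounting_le_mul (δ := 1 / (32 * (K + 1))) (by positivity))
  have hlog := (Real.tendsto_log_atTop.comp (tendsto_natCast_atTop_atTop (R := ℝ))).eventually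
    (eventually_ge_atTop (max (Z : ℝ) (64 * (K + 2))))
  obtain ⟨r₀, hr₀⟩ := eventually_atTop.1 (hlog.and (eventually_gt_atTop 0))
  refine ⟨r₀, fun r hr => ?_⟩
  obtain ⟨hL, hrpos⟩ := hr₀ r hr
  simp only [Function.comp] at hL
  set L := Real.log r with hLdef
  have hLZ : (Z : ℝ) ≤ L := (le_max_left _ _).trans hL
  have hLK : 64 * (K + 2) ≤ L := (le_max_right _ _).trans hL
  have hKL : L ≤ K * L := by nlinarith
  set w := ⌊L / 4⌋₊ with hw
  set z := ⌈K * L⌉₊ + 1 with hz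
  have hw1 : (w : ℝ) ≤ L / 4 := Nat.floor_le (by linarith)
  have hw2 : L / 8 ≤ w := by linarith [Nat.lt_floor_add_one (L / 4)]
  have hz1 : K * L + 1 ≤ z := by
    rw [hz]; push_cast; linarith [Nat.le_ceil (K * L)]
  have hz2 : (z : ℝ) ≤ K * L + 2 := by
    rw [hz]; push_cast; linarith [Nat.ceil_lt_add_one (show 0 ≤ K * L by linarith)]
  have hN := exp_half_le_div_primorial hrpos (by linarith) hw1
  set N := r / primorial w with hNdef
  -- This gives N ≥ L²/8, which beats 4z because L ≥ 64(K + 2).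
  have hquad := Real.quadratic_le_exp_of_nonneg (show 0 ≤ L / 2 by linarith)
  have hzN : 4 * z ≤ N := by
    have : 4 * (z : ℝ) ≤ N := by nlinarith
    exact_mod_cast this
  have hπ : 4 * Nat.primeCounting z ≤ w := by
    have h1 := hZ z (by exact_mod_cast (by linarith : (Z : ℝ) ≤ z))
    have h2 : 1 / (32 * (K + 1)) * (z : ℝ) ≤ L / 32 := by
      rw [one_div, inv_mul_le_iff₀ (by positivity)]
      linarith
    have : 4 * (Nat.primeCounting z : ℝ) ≤ w := by linarith
    exact_mod_cast this
  have hwz : w ≤ z := by exact_mod_cast (by linarith : (w : ℝ) ≤ z)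
  have hw0 : 0 < w := by exact_mod_cast (by linarith : (0 : ℝ) < w)
  have hz2' : 2 ≤ z := by exact_mod_cast (by linarith : (2 : ℝ) ≤ z)
  have hlogN : L / 2 ≤ Real.log N := by
    rw [Real.le_log_iff_exp_le (lt_of_lt_of_le (Real.exp_pos _) hN)]
    exact hN
  have hsum : ∑ p ∈ (Finset.Ioc N r).filter Nat.Prime, (1 / p : ℝ) ≤ 4 := by
    refine (sum_inv_prime_le (by omega) hrpos).trans ?_
    have hlog4 : Real.log 4 ≤ 4 := by
      linarith [Real.log_le_sub_one_of_pos (show (0 : ℝ) < 4 by norm_num)]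
    rw [div_le_iff₀ (by linarith)]
    linarith
  have hprod := prod_one_sub_two_div_ge (by omega) hsum
  rw [show (-4 * 4 : ℝ) = -16 by norm_num, ← hc] at hprod
  refine ⟨primorial w, (expMoment_final_le hw0 hwz hz2' hπ hzN hc0.le hc1 hprod).trans ?_⟩
  have hr' : (0 : ℝ) < r := by exact_mod_cast hrpos
  rw [Real.rpow_def_of_pos hr', one_div, ← Real.exp_neg, Real.exp_le_exp, neg_le_neg_iff, ← hLdef]
  have h1 : c * (K * L) ≤ c * (z - 1) := by gcongr; linarith
  have h2 : c * K = 2 * k + c := by rw [hK]; field_simp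
  have h3 : 0 < c * L := mul_pos hc0 (by linarith)
  nlinarith

theorem theorem4 (k : ℝ) (hk : 0 < k) :
    ∃ c : ℝ, 0 < c ∧ ∀ r : ℕ, 1 < r →
      ∃ d : ℝ, HasAsymptoticDensity (noCoprimeSet r) d ∧ d ≤ c / (r : ℝ) ^ k := by
  classical
  obtain ⟨r₀, hr₀⟩ := expMoment_le_rpow hk
  -- The second entry covers r ≤ r₀, where density at most 1 suffices.
  refine ⟨max 1 ((r₀ : ℝ) ^ k), lt_of_lt_of_le one_pos (le_max_left _ _), fun r hr => ?_⟩
  refine ⟨_, hasAsymptoticDensity_of_periodic (primorial_pos r) (noCoprime_periodic r), ?_⟩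
  have hr' : (0 : ℝ) < (r : ℝ) ^ k := Real.rpow_pos_of_pos (by exact_mod_cast by omega) k
  rcases le_total r₀ r with h | h
  · obtain ⟨M, hM⟩ := hr₀ r h
    refine (count_div_le_expMoment M r _ fun n hn => hn).trans (hM.trans ?_)
    gcongr
    exact le_max_left _ _
  · have hm : (0 : ℝ) < primorial r := by exact_mod_cast primorial_pos r
    calc _ ≤ (1 : ℝ) := by
          rw [div_le_one hm]
          exact_mod_cast Nat.count_le _
      _ ≤ _ := by
          rw [one_le_div hr']
          refine le_trans ?_ (le_max_right _ _)
          gcongr
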